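/- Let $X=\{x=(x_n)_{n\ge 1}\in\mathbb Z^{\mathbb N}: |x_{n+1}-x_n|\le 1\ \forall n\ge 1\}$ be the simple aperiodic random walk shift, with its Borel $\sigma$-algebra and the partition $\alpha=\{[s]:s\in\mathbb Z\}$, $[s]=\{x\in X:x_1=s\}$. Let $\mathcal E$ be the exchangeable relation of $X$: $(x,y)\in\mathcal E$ iff $x,y\in X$ differ by a permutation of finitely many coordinates. A measure $\mu$ on $X$ is $\mathcal E$-invariant (exchangeable) if $\mu(\kappa C)=\mu(C)$ for every bi-measurable bijection $\kappa:A\to B$ between Borel subsets of $X$ with $(x,\kappa x)\in\mathcal E$ for all $x\in A$, and every Borel $C\subseteq A$. It is $\mathcal E$-ergodic if every Borel set that is a union of $\mathcal E$-classes is $\mu$-null or has a $\mu$-null complement. Let $\mathfrak M_\alpha(X)$ be the set of $\sigma$-finite measures $\mu$ on $X$ with $\mu([s])<\infty$ for all $s\in\mathbb Z$. For $s\in\mathbb Z$ let $N_s(x)=\#\{n\ge 1:x_n=s\}\in\{0,1,2,\dots,\infty\}$. A state $s$ is $\mu$-ephemeral if $1\le N_s<\infty$ $\mu$-a.e., and $\mu$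 is ephemeral if every state $s$ that it visits (i.e. for which $N_s=0$ does not hold $\mu$-a.e.) is $\mu$-ephemeral. **Proposition 6.2.** Set $Z:=\{x\in X: N_s(x)=0\ \forall s\le 0,\ N_s(x)=2\ \forall s\ge 1\}$. There is a unique $\mathcal E$-invariant, $\mathcal E$-ergodic measure $\overline\nu\in\mathfrak M_\alpha(X)$ which is carried by $Z$ (that is, $\overline\nu(X\setminus Z)=0$) and such that $\overline\nu([1])=1$. This measure is non-atomic and ephemeral. Moreover, let $p=\frac{\sqrt5-1}{2}$ (so $p+p^2=1$), let $m$ be the product probability measure on $\{1,2\}^{\{0,1,2,\dots\}}$ whose coordinates take the value $1$ with probability $p$ and the value $2$ with probability $p^2$, and let $$\pi(\omega)=\bigl(a(\omega_0)+s_0,\ a(\omega_1)+s_1,\ a(\omega_2)+s_2,\dots\bigr),\qquad a(1)=(1,1),\quad a(2)=(1,2,1,2),\quad s_k=\omega_0+\dots+\omega_{k-1}$$ be the concatenation of the blocks $a(\omega_k)$ with $s_k$ added to all of their entries. Then the restriction of $\overline\nu$ to $[1]$ is the image $m\circ\pi^{-1}$ of $m$ under $\pi$. -/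

import Mathlib

open MeasureTheory Set
open scoped ENNReal

namespace ExchShift

/-! ### Equivalence relations, holonomies, invariance and ergodicity -/

section Relations

variable {X : Type*} [MeasurableSpace X]

/-- A holonomy of the relation `R` from `A` to `B`: a bi-measurable bijection `κ : A → B` between
measurable sets such that `x` and `κ x` are `R`-equivalent for every `x ∈ A`. -/
structure IsHolonomy (R : X → X → Prop) (A B : Set X) (κ : A ≃ᵐ B) : Prop where
  measurableSet_dom : MeasurableSet A
  measurableSet_im : MeasurableSet B
  rel : ∀ x : A, R (x : X) (κ x : X)

/-- `μ` is `R`-invariant: `μ (κ C) = μ C` for every holonomy `κ` of `R` and every measurable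
subset `C` of its domain. -/
def IsInvariant (R : X → X → Prop) (μ : Measure X) : Prop :=
  ∀ (A B : Set X) (κ : A ≃ᵐ B), IsHolonomy R A B κ →
    ∀ C : Set A, MeasurableSet C →
      μ (Subtype.val '' (κ '' C)) = μ (Subtype.val '' C)

/-- `μ` is `R`-ergodic: every measurable `R`-saturated set is null or co-null. -/
def IsErgodic (R : X → X → Prop) (μ : Measure X) : Prop :=
  ∀ A : Set X, MeasurableSet A → (∀ x y : X, R x y → x ∈ A → y ∈ A) →
    μ A = 0 ∨ μ Aᶜ = 0

/-- `μ` has no atoms: every measurable set of positive measure has a measurable subset of positive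
and strictly smaller measure. -/
def IsNonAtomic (μ : Measure X) : Prop :=
  ∀ A : Set X, MeasurableSet A → 0 < μ A → ∃ B ⊆ A, MeasurableSet B ∧ 0 < μ B ∧ μ B < μ A

end Relations

/-! ### Subshifts -/

section Subshift

variable {S : Type*}

/-- The exchangeable relation of `Ω ⊆ S ^ ℕ`: two points of `Ω` are equivalent when they differ by
a permutation of finitely many coordinates. -/
def ExchRel (Ω : Set (ℕ → S)) (x y : Ω) : Prop :=
  ∃ σ : Equiv.Perm ℕ, {n | σ n ≠ n}.Finite ∧ ∀ n, (y : ℕ → S) n = (x : ℕ → S) (σ n)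

/-- The one-symbol cylinder `[s]`, an element of the partition `α`; the coordinates of a sequence
are numbered from `0`. -/
def cyl (Ω : Set (ℕ → S)) (s : S) : Set Ω := {x | (x : ℕ → S) 0 = s}

/-- `N_s x`, the (possibly infinite) number of visits of `x` to the state `s`. -/
noncomputable def visits (s : S) (x : ℕ → S) : ℕ∞ := {n | x n = s}.encard

variable [MeasurableSpace S] {Ω : Set (ℕ → S)}

/-- `μ` is `α`-`σ`-finite: it is `σ`-finite, and finite on each element `[s]` of `α`. -/
def IsAlphaFinite (μ : Measure ↥Ω) : Prop :=
  SigmaFinite μ ∧ ∀ s : S, μ (cyl Ω s) < ∞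

/-- The state `s` is `μ`-ephemeral: almost every point visits it, and only finitely often. -/
def IsEphemeralState (μ : Measure ↥Ω) (s : S) : Prop :=
  ∀ᵐ x : ↥Ω ∂μ, 1 ≤ visits s (x : ℕ → S) ∧ visits s (x : ℕ → S) < ⊤

/-- The measure `μ` is ephemeral: every state that is visited on a set of positive measure
is `μ`-ephemeral. -/
def IsEphemeral (μ : Measure ↥Ω) : Prop :=
  ∀ s : S, (¬ ∀ᵐ x : ↥Ω ∂μ, visits s (x : ℕ → S) = 0) → IsEphemeralState μ s

end Subshift

/-! ### The simple aperiodic random walk shift -/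

/-- The simple aperiodic random walk shift `X ⊆ ℤ ^ ℕ`. -/
def walkShift : Set (ℕ → ℤ) := {x | ∀ n, |x (n + 1) - x n| ≤ 1}

/-- The set `Z` of the paths that visit each `s ≥ 1` exactly twice and no `s ≤ 0`. -/
def twiceVisited : Set walkShift :=
  {x | (∀ s : ℤ, s ≤ 0 → visits s (x : ℕ → ℤ) = 0) ∧
       (∀ s : ℤ, 1 ≤ s → visits s (x : ℕ → ℤ) = 2)}

/-! ### The golden-mean product measure and the block coding

The alphabet `{1, 2}` is represented by `Fin 2`: the element `i` stands for the letter `i + 1`. -/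

/-- The golden-mean number `p = (√5 - 1) / 2`, the positive solution of `p + p ^ 2 = 1`. -/
noncomputable def goldenP : ℝ := (√5 - 1) / 2

/-- The distribution on `{1, 2}` with mass `p` at the letter `1` and mass `p ^ 2` at the
letter `2`. -/
noncomputable def goldenLetter : Measure (Fin 2) :=
  ENNReal.ofReal goldenP • Measure.dirac 0 + ENNReal.ofReal (goldenP ^ 2) • Measure.dirac 1

theorem goldenP_nonneg : 0 ≤ goldenP := by
  have h : (1 : ℝ) ≤ √5 := by
    rw [Real.one_le_sqrt]; norm_num
  unfold goldenP; linarith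

theorem goldenP_add_sq : goldenP + goldenP ^ 2 = 1 := by
  have h : √5 ^ 2 = (5 : ℝ) := Real.sq_sqrt (by norm_num)
  unfold goldenP; nlinarith

instance isProbabilityMeasure_goldenLetter : IsProbabilityMeasure goldenLetter := by
  constructor
  have h : ENNReal.ofReal goldenP + ENNReal.ofReal (goldenP ^ 2) = 1 := by
    rw [← ENNReal.ofReal_add goldenP_nonneg (sq_nonneg _), goldenP_add_sq, ENNReal.ofReal_one]
  simpa [goldenLetter] using h

/-- The golden-mean product measure on `{1, 2} ^ ℕ`. -/
noncomputable def goldenMeasure : Measure (ℕ → Fin 2) :=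
  Measure.infinitePi fun _ => goldenLetter

/-- The path coded by `ω ∈ {1, 2} ^ ℕ`: the concatenation of the blocks `a (ω k) + s k`, `k ≥ 0`,
where `a 1 = (1, 1)`, `a 2 = (1, 2, 1, 2)` and `s k = ω 0 + ... + ω (k - 1)`.  The recursion splits
off the first block; the rest is the path coded by the shifted sequence, raised by `ω 0`. -/
def blockPath (ω : ℕ → Fin 2) (n : ℕ) : ℤ :=
  if ω 0 = 0 then
    if n < 2 then 1
    else 1 + blockPath (fun k => ω (k + 1)) (n - 2)
  else
    if n < 4 then (if n % 2 = 0 then 1 else 2)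
    else 2 + blockPath (fun k => ω (k + 1)) (n - 4)
termination_by n

end ExchShift

namespace ExchShift

/-! ### Visits of concatenated paths -/

/-! The set $Z$ is coded by countably many copies of $\{1,2\}^{\mathbb N}$. A path of $Z$ that
starts in $1$ must begin with $1,1$ or $1,2,1,2$, since any other return to $1$ would visit $2$
three times. After this block it is a raised path of the same kind, so it is `blockPath ω` for a
unique $ω$. A path that starts in $s+1\ge 2$ must run straight down to $1$, repeat it and run
straight up again, which uses both visits to each level up to $s+1$; then blocks follow. Hence $Z$
is the disjoint union of the ranges of `code s`, where the free part starts at height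
$L_s=0,2,3,\dots$. Height $1$ is absent because the opening $1,1$ is already the first letter of a
code of index $0$.

All points of $Z$ visit each state equally often, so two of them are exchangeable iff they agree
eventually. In codes: they have a common tail after prefixes of equal total height
$L_s+\text{weight}(u)$ (`exchRel_code`, `ExchRel.exists_prepend`). An invariant measure therefore
gives all prefixes of height $k$ the same mass $q_k$, and splitting off one more letter gives
$q_k=q_{k+1}+q_{k+2}$. The only bounded solution with $q_0=1$ is $q_k=p^k$, which is uniqueness
(`eq_goldenMeasure`, `eq_exchMeasure`).

Conversely, $\sum_s p^{L_s}\,m\circ\mathrm{code}_s^{-1}$ is finite, and it is invariant because a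
holonomy is, piecewise on $Z$, an exchange of prefixes of equal height. For a saturated set $A$, the
conditional measure of $A$ given a prefix depends only on its height and is a bounded solution of
$f_k=pf_{k+1}+p^2f_{k+2}$, hence constant. So $A$ is independent of all cylinders, thus of itself,
which is ergodicity (`goldenMeasure_zero_or_one`). -/

theorem visits_eq_of_tail {x y : ℕ → ℤ} {N : ℕ} {L : ℤ} (h : ∀ n, x (N + n) = L + y n) (t : ℤ) :
    visits t x = (((Finset.range N).filter fun k => x k = t).card : ℕ∞) + visits (t - L) y := by
  have hset : {n | x n = t} =
      (((Finset.range N).filter fun k => x k = t : Finset ℕ) : Set ℕ) ∪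
        (fun n => N + n) '' {n | y n = t - L} := by
    ext n
    simp only [mem_ofPred_eq, Finset.coe_filter, Finset.mem_range, mem_union, mem_image]
    constructor
    · intro hn
      rcases lt_or_ge n N with h1 | h1
      · exact Or.inl ⟨h1, hn⟩
      · obtain ⟨k, rfl⟩ := Nat.exists_eq_add_of_le h1
        exact Or.inr ⟨k, by have := h k; omega, rfl⟩
    · rintro (h1 | ⟨k, hk, rfl⟩)
      · exact h1.2
      · have := h k; omega
  unfold visits
  rw [hset, encard_union_eq, encard_coe_eq_coe_finsetCard, Function.Injective.encard_image]
  · exact fun a b hab => by simpa using hab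
  · rw [Set.disjoint_left]
    rintro n hn ⟨k, -, rfl⟩
    simp at hn

theorem visits_eq_zero_iff {x : ℕ → ℤ} {t : ℤ} : visits t x = 0 ↔ ∀ n, x n ≠ t := by
  unfold visits
  rw [encard_eq_zero, eq_empty_iff_forall_notMem]
  rfl

theorem visits_eq_two_iff {x : ℕ → ℤ} {t : ℤ} :
    visits t x = 2 ↔ ∃ a b, a < b ∧ ∀ n, x n = t ↔ n = a ∨ n = b := by
  unfold visits
  rw [encard_eq_two]
  constructor
  · rintro ⟨a, b, hab, h⟩
    have h' : ∀ n, x n = t ↔ n = a ∨ n = b := fun n => by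
      have := Set.ext_iff.1 h n
      simpa using this
    rcases lt_or_gt_of_ne hab with h1 | h1
    · exact ⟨a, b, h1, h'⟩
    · exact ⟨b, a, h1, fun n => (h' n).trans or_comm⟩
  · rintro ⟨a, b, hab, h⟩
    exact ⟨a, b, hab.ne, by ext n; simpa using h n⟩

/-- The paths that visit each `s ≥ 1` exactly twice and no `s ≤ 0`, as plain sequences. -/
structure IsTwicePath (x : ℕ → ℤ) : Prop where
  step : ∀ n, |x (n + 1) - x n| ≤ 1
  visits_nonpos : ∀ s ≤ 0, visits s x = 0
  visits_pos : ∀ s, 1 ≤ s → visits s x = 2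

theorem isTwicePath_iff {x : walkShift} : IsTwicePath (x : ℕ → ℤ) ↔ x ∈ twiceVisited :=
  ⟨fun h => ⟨h.2, h.3⟩, fun h => ⟨x.2, h.1, h.2⟩⟩

theorem IsTwicePath.one_le {x : ℕ → ℤ} (h : IsTwicePath x) (n : ℕ) : 1 ≤ x n := by
  by_contra hn
  exact visits_eq_zero_iff.1 (h.visits_nonpos (x n) (by omega)) n rfl

/-- The tail of a path after all the visits to the states `1, ..., L`. -/
theorem IsTwicePath.tail {x y : ℕ → ℤ} (hx : IsTwicePath x) {N L : ℕ}
    (h : ∀ n, x (N + n) = L + y n) (hpre : ∀ k < N, x k ≤ L)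
    (hpost : ∀ k, N ≤ k → (L : ℤ) < x k) : IsTwicePath y where
  step n := by
    have h1 := hx.step (N + n)
    have h2 := h n
    have h3 := h (n + 1)
    rw [← add_assoc] at h3
    rw [h2, h3] at h1
    simpa using h1
  visits_nonpos s hs := by
    rw [visits_eq_zero_iff]
    intro n hn
    have := hpost (N + n) (by omega)
    have := h n
    omega
  visits_pos s hs := by
    have h1 := visits_eq_of_tail h (s + L)
    rw [hx.visits_pos _ (by omega), add_sub_cancel_right, Finset.filter_false_of_mem] at h1
    · simpa using h1.symm
    · intro k hk hk'
      have := hpre k (Finset.mem_range.1 hk)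
      omega

/-- A word of length `2 L` that visits each of `1, ..., L` twice, followed by a raised path. -/
theorem IsTwicePath.glue {x y : ℕ → ℤ} (hy : IsTwicePath y) {N L : ℕ}
    (h : ∀ n, x (N + n) = L + y n) (hstep : ∀ n < N, |x (n + 1) - x n| ≤ 1)
    (hcard : ∀ t : ℤ, ((Finset.range N).filter fun k => x k = t).card =
      if 1 ≤ t ∧ t ≤ L then 2 else 0) : IsTwicePath x where
  step n := by
    rcases lt_or_ge n N with h1 | h1
    · exact hstep n h1
    · obtain ⟨k, rfl⟩ := Nat.exists_eq_add_of_le h1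
      rw [add_assoc, h, h]
      simpa using hy.step k
  visits_nonpos s hs := by
    rw [visits_eq_of_tail h, hcard, hy.visits_nonpos _ (by omega), if_neg (by omega)]
    rfl
  visits_pos s hs := by
    rw [visits_eq_of_tail h, hcard]
    by_cases h1 : s ≤ L
    · rw [hy.visits_nonpos _ (by omega), if_pos ⟨hs, h1⟩]
      rfl
    · rw [hy.visits_pos _ (by omega), if_neg (by omega)]
      rfl

/-! ### The block coding -/

/-- The sequence with first letter `i` and tail `ω`. -/
def consSeq (i : Fin 2) (ω : ℕ → Fin 2) : ℕ → Fin 2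
  | 0 => i
  | n + 1 => ω n

/-- The sequence that starts with the word `u` and continues with `ω`. -/
def prepend : List (Fin 2) → (ℕ → Fin 2) → ℕ → Fin 2
  | [], ω => ω
  | i :: u, ω => consSeq i (prepend u ω)

/-- The sum of the letters of a word in the alphabet `{1, 2}`. -/
def weight : List (Fin 2) → ℕ
  | [] => 0
  | i :: u => (i : ℕ) + 1 + weight u

theorem consSeq_head_tail (ω : ℕ → Fin 2) : consSeq (ω 0) (fun k => ω (k + 1)) = ω := by
  funext n
  cases n <;> rfl

theorem consSeq_injective (i : Fin 2) : Function.Injective (consSeq i) := fun ω ω' h => by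
  funext n
  exact congrFun h (n + 1)

theorem prepend_injective (u : List (Fin 2)) : Function.Injective (prepend u) := by
  induction u with
  | nil => exact fun _ _ h => h
  | cons i u ih => exact fun _ _ h => ih (consSeq_injective i h)

theorem prepend_append (u v : List (Fin 2)) (ω : ℕ → Fin 2) :
    prepend (u ++ v) ω = prepend u (prepend v ω) := by
  induction u with
  | nil => rfl
  | cons i u ih => simp [prepend, ih]

theorem weight_append (u v : List (Fin 2)) : weight (u ++ v) = weight u + weight v := by
  induction u with
  | nil => simp [weight]
  | cons i u ih => simp [weight, ih]; ring

theorem blockPath_consSeq_zero (ω : ℕ → Fin 2) (n : ℕ) :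
    blockPath (consSeq 0 ω) n = if n < 2 then 1 else 1 + blockPath ω (n - 2) := by
  rw [blockPath, if_pos (show consSeq 0 ω 0 = 0 from rfl)]
  rfl

theorem blockPath_consSeq_one (ω : ℕ → Fin 2) (n : ℕ) :
    blockPath (consSeq 1 ω) n =
      if n < 4 then (if n % 2 = 0 then 1 else 2) else 2 + blockPath ω (n - 4) := by
  rw [blockPath, if_neg (by simp [consSeq])]
  rfl

theorem blockPath_consSeq_tail (i : Fin 2) (ω : ℕ → Fin 2) (n : ℕ) :
    blockPath (consSeq i ω) (2 * ((i : ℕ) + 1) + n) = ((i : ℕ) + 1 : ℕ) + blockPath ω n := by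
  fin_cases i
  · rw [show (⟨0, by decide⟩ : Fin 2) = 0 from rfl, blockPath_consSeq_zero,
      if_neg (by simp; try omega)]
    simp
  · rw [show (⟨1, by decide⟩ : Fin 2) = 1 from rfl, blockPath_consSeq_one,
      if_neg (by simp; try omega)]
    simp

theorem blockPath_zero (ω : ℕ → Fin 2) : blockPath ω 0 = 1 := by
  rw [blockPath]; simp

theorem blockPath_one (ω : ℕ → Fin 2) : blockPath ω 1 = ((ω 0 : ℕ) : ℤ) + 1 := by
  rw [blockPath]
  generalize ω 0 = i
  fin_cases i <;> simp

theorem one_le_blockPath (ω : ℕ → Fin 2) (n : ℕ) : 1 ≤ blockPath ω n := by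
  induction n using Nat.strong_induction_on generalizing ω with
  | _ n ih =>
    rw [blockPath]
    split_ifs with h1 h2 h3 h4
    · rfl
    · have := ih (n - 2) (by omega) (fun k => ω (k + 1)); omega
    · rfl
    · norm_num
    · have := ih (n - 4) (by omega) (fun k => ω (k + 1)); omega

theorem card_filter_blockPath_consSeq (i : Fin 2) (ω : ℕ → Fin 2) (t : ℤ) :
    ((Finset.range (2 * ((i : ℕ) + 1))).filter fun k => blockPath (consSeq i ω) k = t).card =
      if 1 ≤ t ∧ t ≤ ((i : ℕ) + 1 : ℕ) then 2 else 0 := by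
  rw [Finset.card_filter]
  fin_cases i
  · change ∑ k ∈ Finset.range 2, _ = _
    rw [Finset.sum_range_succ, Finset.sum_range_succ, Finset.sum_range_zero]
    simp [blockPath_consSeq_zero]
    split_ifs <;> omega
  · change ∑ k ∈ Finset.range 4, _ = _
    rw [Finset.sum_range_succ, Finset.sum_range_succ, Finset.sum_range_succ,
      Finset.sum_range_succ, Finset.sum_range_zero]
    simp [blockPath_consSeq_one]
    split_ifs <;> omega

/-- The induction is on a bound for the state, not on time: dropping the first block lowers the
state by at least one. -/
theorem visits_blockPath (n : ℕ) (ω : ℕ → Fin 2) (t : ℤ) (ht : t ≤ n) :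
    visits t (blockPath ω) = if 1 ≤ t then 2 else 0 := by
  induction n generalizing ω t with
  | zero =>
    rw [if_neg (by omega), visits_eq_zero_iff]
    intro k
    have := one_le_blockPath ω k
    omega
  | succ n ih =>
    have h := visits_eq_of_tail (blockPath_consSeq_tail (ω 0) (fun k => ω (k + 1))) t
    rw [card_filter_blockPath_consSeq, consSeq_head_tail,
      ih (fun k => ω (k + 1)) _ (by push_cast at ht ⊢; omega)] at h
    rw [h]
    split_ifs <;> first | omega | rfl

theorem blockPath_step (ω : ℕ → Fin 2) (n : ℕ) : |blockPath ω (n + 1) - blockPath ω n| ≤ 1 := by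
  induction n using Nat.strong_induction_on generalizing ω with
  | _ n ih =>
    rw [← consSeq_head_tail ω]
    generalize ω 0 = i
    generalize (fun k => ω (k + 1)) = η
    rcases lt_or_ge n (2 * ((i : ℕ) + 1)) with h | h
    · fin_cases i
      · have h' : n < 2 := by simpa using h
        interval_cases n <;> simp [blockPath_consSeq_zero, blockPath_zero]
      · have h' : n < 4 := by simpa using h
        interval_cases n <;> simp [blockPath_consSeq_one, blockPath_zero]
    · obtain ⟨k, rfl⟩ := Nat.exists_eq_add_of_le h
      rw [add_assoc, blockPath_consSeq_tail, blockPath_consSeq_tail]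
      simpa using ih k (by omega) η

theorem isTwicePath_blockPath (ω : ℕ → Fin 2) : IsTwicePath (blockPath ω) where
  step := blockPath_step ω
  visits_nonpos s hs := by rw [visits_blockPath 0 ω s (by simpa using hs), if_neg (by omega)]
  visits_pos s hs := by rw [visits_blockPath s.toNat ω s (by omega), if_pos hs]

theorem blockPath_prepend_tail (u : List (Fin 2)) (ω : ℕ → Fin 2) (n : ℕ) :
    blockPath (prepend u ω) (2 * weight u + n) = weight u + blockPath ω n := by
  induction u with
  | nil => simp [weight, prepend]
  | cons i u ih =>
    have : 2 * weight (i :: u) + n = 2 * ((i : ℕ) + 1) + (2 * weight u + n) := by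
      simp [weight]; ring
    rw [this, prepend, blockPath_consSeq_tail, ih]
    simp [weight]; ring

/-- The entry at time 1 reveals the first letter; the tail after that block codes the remaining
letters. -/
theorem blockPath_injective : Function.Injective blockPath := by
  have key : ∀ n, ∀ ω ω' : ℕ → Fin 2, blockPath ω = blockPath ω' → ω n = ω' n := by
    intro n
    induction n with
    | zero =>
      intro ω ω' h
      have h1 := congrFun h 1
      rw [blockPath_one, blockPath_one] at h1
      ext
      omega
    | succ n ih =>
      intro ω ω' h
      have h0 : ω 0 = ω' 0 := by
        have h1 := congrFun h 1
        rw [blockPath_one, blockPath_one] at h1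
        ext
        omega
      refine ih (fun k => ω (k + 1)) (fun k => ω' (k + 1)) ?_
      funext k
      have h1 := blockPath_consSeq_tail (ω 0) (fun k => ω (k + 1)) k
      have h2 := blockPath_consSeq_tail (ω' 0) (fun k => ω' (k + 1)) k
      rw [consSeq_head_tail] at h1 h2
      rw [← h0, ← h] at h2
      linarith
  exact fun ω ω' h => funext fun n => key n ω ω' h

/-- Every path of `Z` that starts in `1` begins with one of the two blocks. -/
theorem IsTwicePath.exists_block {x : ℕ → ℤ} (hx : IsTwicePath x) (h0 : x 0 = 1) :
    ∃ (i : Fin 2) (y : ℕ → ℤ), IsTwicePath y ∧ y 0 = 1 ∧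
      (∀ n, x (2 * ((i : ℕ) + 1) + n) = ((i : ℕ) + 1 : ℕ) + y n) ∧
      ∀ n < 2 * ((i : ℕ) + 1), ∀ ω, x n = blockPath (consSeq i ω) n := by
  have hstep : ∀ n, x (n + 1) ≤ x n + 1 ∧ x n ≤ x (n + 1) + 1 := fun n => by
    have := abs_le.1 (hx.step n); omega
  have hpos := hx.one_le
  obtain ⟨a, b, hab, h1⟩ := visits_eq_two_iff.1 (hx.visits_pos 1 le_rfl)
  obtain ⟨c, d, hcd, h2⟩ := visits_eq_two_iff.1 (hx.visits_pos 2 (by norm_num))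
  have ha : a = 0 := by have := (h1 0).1 h0; omega
  subst ha
  by_cases hx1 : x 1 = 1
  · have hb : b = 1 := by have := (h1 1).1 hx1; omega
    subst hb
    have hge : ∀ n, 2 ≤ n → 1 < x n := fun n hn => by
      have := hpos n
      have := h1 n
      omega
    have htail : ∀ n, x (2 + n) = (1 : ℕ) + (fun n => x (2 + n) - 1) n := fun n => by simp
    refine ⟨0, fun n => x (2 + n) - 1, hx.tail htail ?_ (by simpa using hge), ?_, htail, ?_⟩
    · intro k hk; interval_cases k <;> simp [h0, hx1]
    · have := hge 2 le_rfl; have := hstep 1; simp at *; omega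
    · intro n hn ω
      have hn' : n < 2 := by simpa using hn
      interval_cases n <;> simp [blockPath_consSeq_zero, h0, hx1]
  · have hx1' : x 1 = 2 := by have := hstep 0; have := hpos 1; simp at *; omega
    have hb1 : b ≠ 1 := fun h => hx1 ((h1 1).2 (Or.inr h.symm))
    have hxb : x b = 1 := (h1 b).2 (Or.inr rfl)
    obtain ⟨e, rfl⟩ : ∃ e, b = e + 2 := ⟨b - 2, by omega⟩
    have hm : x (e + 1) = 2 := by
      have := hstep (e + 1); have := hpos (e + 1); have := h1 (e + 1)
      rw [add_assoc] at *; norm_num at *; omega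
    have hp : x (e + 3) = 2 := by
      have := hstep (e + 2); have := hpos (e + 3); have := h1 (e + 3)
      rw [add_assoc] at *; norm_num at *; omega
    -- Both neighbours of the second visit to 1 are visits to 2, and so is time 1. Only two visits
    -- to 2 are allowed, so times `1` and `e + 1` coincide.
    have he : e = 0 := by
      have := (h2 _).1 hx1'; have := (h2 _).1 hm; have := (h2 _).1 hp; omega
    subst he
    simp only [zero_add] at hm hp hxb h1
    have hc : c = 1 ∧ d = 3 := by have := (h2 _).1 hx1'; have := (h2 _).1 hp; omega
    obtain ⟨rfl, rfl⟩ := hc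
    have hge : ∀ n, 4 ≤ n → 2 < x n := fun n hn => by
      have := hpos n
      have := h1 n
      have := h2 n
      omega
    have htail : ∀ n, x (4 + n) = (2 : ℕ) + (fun n => x (4 + n) - 2) n := fun n => by simp
    refine ⟨1, fun n => x (4 + n) - 2, hx.tail htail ?_ (by simpa using hge), ?_, htail, ?_⟩
    · intro k hk; interval_cases k <;> simp [h0, hx1', hxb, hp]
    · have := hge 4 le_rfl; have := hstep 3; simp at *; omega
    · intro n hn ω
      have hn' : n < 4 := by simpa using hn
      interval_cases n <;> simp [blockPath_consSeq_one, h0, hx1', hxb, hp]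

/-- Splitting off blocks is iterated as a self-map `next` of the paths starting in 1. Since blocks
have positive length, strong induction on time identifies the coded path with the given one. -/
theorem IsTwicePath.exists_blockPath {x : ℕ → ℤ} (hx : IsTwicePath x) (h0 : x 0 = 1) :
    ∃ ω, blockPath ω = x := by
  let T := {x : ℕ → ℤ // IsTwicePath x ∧ x 0 = 1}
  choose i y hy hy0 htail hpre using fun x : T => x.2.1.exists_block x.2.2
  let next : T → T := fun x => ⟨y x, hy x, hy0 x⟩
  let code : T → ℕ → Fin 2 := fun x k => i (next^[k] x)
  have hcode : ∀ x, code x = consSeq (i x) (code (next x)) := fun x => by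
    funext k
    cases k <;> rfl
  have key : ∀ n, ∀ x : T, blockPath (code x) n = x.1 n := by
    intro n
    induction n using Nat.strong_induction_on with
    | _ n ih =>
      intro x
      rw [hcode]
      rcases lt_or_ge n (2 * ((i x : ℕ) + 1)) with h | h
      · exact (hpre x n h _).symm
      · obtain ⟨k, rfl⟩ := Nat.exists_eq_add_of_le h
        rw [blockPath_consSeq_tail, htail, ih k (by omega)]
  exact ⟨code ⟨x, hx, h0⟩, funext fun n => key n ⟨x, hx, h0⟩⟩

/-! ### Coding of all of `Z` -/

/-- The level at which the code of index `s` starts: `0, 2, 3, 4, ...`. -/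
def startLevel (s : ℕ) : ℕ := if s = 0 then 0 else s + 1

/-- The path that goes straight down from `L` to `1`, stays there once, climbs back to `L`, and then
follows the path coded by `ω`, raised by `L = startLevel s`.  For `s = 0` the first part is empty. -/
def codeSeq (s : ℕ) (ω : ℕ → Fin 2) (n : ℕ) : ℤ :=
  if n < startLevel s then (startLevel s : ℤ) - n
  else if n < 2 * startLevel s then (n : ℤ) - startLevel s + 1
  else startLevel s + blockPath ω (n - 2 * startLevel s)

theorem codeSeq_zero_left (ω : ℕ → Fin 2) : codeSeq 0 ω = blockPath ω := by
  funext n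
  simp [codeSeq, startLevel]

theorem codeSeq_apply_zero (s : ℕ) (ω : ℕ → Fin 2) :
    codeSeq s ω 0 = if s = 0 then 1 else (s : ℤ) + 1 := by
  unfold codeSeq startLevel
  split_ifs <;> simp_all [blockPath_zero]

theorem codeSeq_tail (s : ℕ) (u : List (Fin 2)) (ω : ℕ → Fin 2) (n : ℕ) :
    codeSeq s (prepend u ω) (2 * (startLevel s + weight u) + n) =
      (startLevel s + weight u : ℕ) + blockPath ω n := by
  have h : 2 * (startLevel s + weight u) + n - 2 * startLevel s = 2 * weight u + n := by omega
  rw [codeSeq, if_neg (by omega), if_neg (by omega), h, blockPath_prepend_tail]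
  push_cast
  ring

theorem codeSeq_tail_nil (s : ℕ) (ω : ℕ → Fin 2) (n : ℕ) :
    codeSeq s ω (2 * startLevel s + n) = startLevel s + blockPath ω n :=
  codeSeq_tail s [] ω n

theorem isTwicePath_codeSeq (s : ℕ) (ω : ℕ → Fin 2) : IsTwicePath (codeSeq s ω) := by
  refine (isTwicePath_blockPath ω).glue (codeSeq_tail_nil s ω) ?_ ?_
  · intro n hn
    rw [abs_le]
    have h0 := blockPath_zero ω
    have h1 : n + 1 = 2 * startLevel s → blockPath ω (n + 1 - 2 * startLevel s) = 1 := fun h => by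
      rw [h, Nat.sub_self, h0]
    unfold codeSeq
    split_ifs <;> push_cast <;> omega
  · intro t
    by_cases ht : 1 ≤ t ∧ t ≤ startLevel s
    · rw [if_pos ht, Finset.card_eq_two]
      -- The descent passes level `t` at time `L - t`, the ascent at time `L + t - 1`, where `L =
      -- startLevel s`.
      refine ⟨(startLevel s - t).toNat, (startLevel s + t - 1).toNat, by omega, ?_⟩
      ext k
      simp only [Finset.mem_filter, Finset.mem_range, Finset.mem_insert, Finset.mem_singleton]
      unfold codeSeq
      constructor
      · rintro ⟨hk, h⟩
        split_ifs at h <;> omega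
      · intro hk
        refine ⟨by omega, ?_⟩
        split_ifs <;> omega
    · rw [if_neg ht, Finset.card_eq_zero, Finset.filter_eq_empty_iff]
      intro k hk
      rw [Finset.mem_range] at hk
      unfold codeSeq
      split_ifs <;> omega

theorem codeSeq_inj {s s' : ℕ} {ω ω' : ℕ → Fin 2} (h : codeSeq s ω = codeSeq s' ω') :
    s = s' ∧ ω = ω' := by
  have hs : s = s' := by
    have h0 := congrFun h 0
    rw [codeSeq_apply_zero, codeSeq_apply_zero] at h0
    split_ifs at h0 <;> omega
  subst hs
  refine ⟨rfl, blockPath_injective (funext fun n => ?_)⟩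
  have h1 := codeSeq_tail_nil s ω n
  rw [h, codeSeq_tail_nil] at h1
  linarith

/-- A path of `Z` that starts in `s + 1` goes straight down to `1` and straight back up: this gives
the times at which it visits each state `j ≤ s + 1`. -/
theorem IsTwicePath.eq_iff_of_start {x : ℕ → ℤ} (hx : IsTwicePath x) {s : ℕ} (hs : 1 ≤ s)
    (h0 : x 0 = (s : ℤ) + 1) :
    ∀ j : ℕ, 1 ≤ j → j ≤ s + 1 → ∀ n, x n = j ↔ n + j = s + 1 ∨ n + 1 = s + 1 + j := by
  have hstep : ∀ n, x (n + 1) ≤ x n + 1 ∧ x n ≤ x (n + 1) + 1 := fun n => by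
    have := abs_le.1 (hx.step n); omega
  have hpos := hx.one_le
  obtain ⟨a, b, hab, h1⟩ := visits_eq_two_iff.1 (hx.visits_pos 1 le_rfl)
  obtain ⟨c, d, hcd, h2⟩ := visits_eq_two_iff.1 (hx.visits_pos 2 (by norm_num))
  have ha : a ≠ 0 := fun h => by have := (h1 0).2 (Or.inl h.symm); omega
  -- If the two visits to 1 were not consecutive, then times `a - 1`, `a + 1` and `b + 1` would be
  -- three visits to 2.
  have hb : b = a + 1 := by
    obtain ⟨e, rfl⟩ := Nat.exists_eq_succ_of_ne_zero ha
    have e1 : x e = 2 := by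
      have := hstep e; have := (h1 (e + 1)).2 (Or.inl rfl); have := hpos e; have := h1 e; omega
    have e2 : x (b + 1) = 2 := by
      have := hstep b; have := (h1 b).2 (Or.inr rfl); have := hpos (b + 1)
      have := h1 (b + 1); omega
    by_contra hne
    have e3 : x (e + 2) = 2 := by
      have := hstep (e + 1); have := (h1 (e + 1)).2 (Or.inl rfl); have := hpos (e + 2)
      have := h1 (e + 2); simp only [add_assoc, Nat.reduceAdd] at *; omega
    have := (h2 _).1 e1; have := (h2 _).1 e2; have := (h2 _).1 e3
    omega
  subst hb
  -- Induction outward from the central pair `1, 1` at times `a`, `a + 1`. The levels up to `k`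
  -- occupy exactly the `2 * k` central times, so both adjacent times must be at level `k + 1`, and
  -- these are its two visits.
  have key : ∀ k j : ℕ, j ≤ k → 1 ≤ j → j ≤ s + 1 →
      ∀ n, x n = j ↔ n + j = a + 1 ∨ n = a + j := by
    intro k
    induction k with
    | zero => intro j h h'; omega
    | succ k ih =>
      intro j hj hj1 hjs
      rcases Nat.lt_or_ge j (k + 1) with h | h
      · exact ih j (by omega) hj1 hjs
      · obtain rfl : j = k + 1 := by omega
        rcases Nat.eq_zero_or_pos k with rfl | hk
        · intro n
          have := h1 n
          push_cast
          omega
        · have hk' := ih k le_rfl hk (by omega)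
          -- Otherwise level `a + 1 ≤ k` would be visited at time 0, where the path is at `s + 1 >
          -- k`.
          have hak : k ≤ a := by
            by_contra hcon
            have := (ih (a + 1) (by omega) (by omega) (by omega) 0).2 (Or.inl (by omega))
            omega
          have low : ∀ n, x n ≤ k → ∃ i : ℕ, 1 ≤ i ∧ i ≤ k ∧ (n + i = a + 1 ∨ n = a + i) := by
            intro n hn
            have := hpos n
            obtain ⟨i, hi⟩ := Int.eq_ofNat_of_zero_le (show 0 ≤ x n by omega)
            exact ⟨i, by omega, by omega, (ih i (by omega) (by omega) (by omega) n).1 (by omega)⟩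
          have l1 : x (a - k) = (k + 1 : ℕ) := by
            have q1 := hstep (a - k)
            have q2 := (hk' (a - k + 1)).2 (Or.inl (by omega))
            by_contra hne
            obtain ⟨i, _, _, _⟩ := low (a - k) (by push_cast at hne; omega)
            omega
          have l2 : x (a + (k + 1)) = (k + 1 : ℕ) := by
            have q1 := hstep (a + k)
            have q2 := (hk' (a + k)).2 (Or.inr rfl)
            rw [add_assoc] at q1
            by_contra hne
            obtain ⟨i, _, _, _⟩ := low (a + (k + 1)) (by push_cast at hne; omega)
            omega
          obtain ⟨c', d', hcd', h3⟩ :=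
            visits_eq_two_iff.1 (hx.visits_pos (k + 1 : ℕ) (by push_cast; omega))
          intro n
          have r1 := (h3 _).1 l1
          have r2 := (h3 _).1 l2
          rw [h3]
          omega
  have has : a = s := by
    have := (key (s + 1) (s + 1) le_rfl (by omega) le_rfl 0).1 (by push_cast; omega)
    omega
  subst has
  intro j hj hja n
  rw [key j j le_rfl hj hja]
  omega

theorem IsTwicePath.exists_codeSeq {x : ℕ → ℤ} (hx : IsTwicePath x) :
    ∃ s ω, codeSeq s ω = x := by
  have h1 := hx.one_le 0
  obtain ⟨s, hs⟩ := Int.eq_ofNat_of_zero_le (show 0 ≤ x 0 - 1 by omega)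
  rcases Nat.eq_zero_or_pos s with rfl | hpos
  · obtain ⟨ω, hω⟩ := hx.exists_blockPath (by omega)
    exact ⟨0, ω, by rw [codeSeq_zero_left, hω]⟩
  · have hv := hx.eq_iff_of_start hpos (by omega)
    have hL : startLevel s = s + 1 := if_neg (by omega)
    have hlow : ∀ n, x n ≤ (s + 1 : ℕ) → n < 2 * (s + 1) := by
      intro n hn
      have := hx.one_le n
      obtain ⟨i, hi⟩ := Int.eq_ofNat_of_zero_le (show 0 ≤ x n by omega)
      have := (hv i (by omega) (by omega) n).1 (by omega)
      omega
    have hdown : ∀ n < s + 1, x n = (s : ℤ) + 1 - n := fun n hn => by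
      have := (hv (s + 1 - n) (by omega) (by omega) n).2 (by omega)
      omega
    have hup : ∀ n, s + 1 ≤ n → n < 2 * (s + 1) → x n = n - s := fun n hn hn' => by
      have := (hv (n - s) (by omega) (by omega) n).2 (by omega)
      omega
    have htail : ∀ n, x (2 * (s + 1) + n) =
        (s + 1 : ℕ) + (fun n => x (2 * (s + 1) + n) - (s + 1 : ℕ)) n := fun n => by simp
    obtain ⟨ω, hω⟩ := (hx.tail htail
      (fun k hk => by
        rcases Nat.lt_or_ge k (s + 1) with h | h
        · rw [hdown k h]; push_cast; omega
        · rw [hup k h hk]; push_cast; omega)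
      (fun k hk => by
        by_contra hcon
        have := hlow k (by omega)
        omega)).exists_blockPath (by
          have q1 := hup (2 * s + 1) (by omega) (by omega)
          have q2 := abs_le.1 (hx.step (2 * s + 1))
          have q3 : ¬ x (2 * (s + 1)) ≤ (s + 1 : ℕ) := fun h => by have := hlow _ h; omega
          have e : 2 * s + 1 + 1 = 2 * (s + 1) := by ring
          rw [e] at q2
          simp only [add_zero]
          push_cast at q1 q3 ⊢
          omega)
    refine ⟨s, ω, funext fun n => ?_⟩
    rw [codeSeq, hL]
    split_ifs with h h'
    · rw [hdown n h]; push_cast; ring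
    · rw [hup n (by omega) h']; push_cast; ring
    · rw [hω]
      have e : 2 * (s + 1) + (n - 2 * (s + 1)) = n := by omega
      simp [e]

/-! ### The exchangeable relation on `Z` -/

/-- Equal fibre sizes allow the fibres of `g` to be matched with those of `f`, value by value. -/
theorem exists_perm_comp_eq {α : Type*} [DecidableEq α] {N : ℕ} {f g : Fin N → α}
    (h : ∀ a, Fintype.card {k // f k = a} = Fintype.card {k // g k = a}) :
    ∃ σ : Equiv.Perm (Fin N), ∀ k, g k = f (σ k) := by
  refine ⟨(Equiv.sigmaFiberEquiv g).symm.trans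
    ((Equiv.sigmaCongrRight fun a => Fintype.equivOfCardEq (h a).symm).trans
      (Equiv.sigmaFiberEquiv f)), fun k => ?_⟩
  exact ((Fintype.equivOfCardEq (h (g k)).symm) ⟨k, rfl⟩).2.symm

/-- The total visit counts agree and are finite. Cancelling the visits of the common tail leaves
equal counts on the first `N` coordinates, so a permutation of these suffices. -/
theorem exchRel_of_eventually_eq {x y : walkShift} (hx : IsTwicePath (x : ℕ → ℤ))
    (hy : IsTwicePath (y : ℕ → ℤ)) {N : ℕ} (h : ∀ n, N ≤ n → (x : ℕ → ℤ) n = (y : ℕ → ℤ) n) :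
    ExchRel walkShift x y := by
  have hv : ∀ t, visits t (x : ℕ → ℤ) = visits t (y : ℕ → ℤ) := fun t => by
    rcases le_or_gt t 0 with ht | ht
    · rw [hx.visits_nonpos t ht, hy.visits_nonpos t ht]
    · rw [hx.visits_pos t ht, hy.visits_pos t ht]
  have hfin : ∀ t, visits t (fun n => (x : ℕ → ℤ) (N + n)) ≠ ⊤ := fun t ht => by
    have h1 := visits_eq_of_tail (x := (x : ℕ → ℤ)) (y := fun n => (x : ℕ → ℤ) (N + n)) (N := N)
      (L := 0) (fun n => by simp) t
    rw [sub_zero, ht] at h1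
    rcases le_or_gt t 0 with h0 | h0
    · rw [hx.visits_nonpos t h0] at h1; simp at h1
    · rw [hx.visits_pos t h0] at h1; simp at h1
  have hcard : ∀ t, ((Finset.range N).filter fun k => (x : ℕ → ℤ) k = t).card =
      ((Finset.range N).filter fun k => (y : ℕ → ℤ) k = t).card := fun t => by
    have h1 := visits_eq_of_tail (x := (x : ℕ → ℤ)) (y := fun n => (x : ℕ → ℤ) (N + n)) (N := N)
      (L := 0) (fun n => by simp) t
    have h2 := visits_eq_of_tail (x := (y : ℕ → ℤ)) (y := fun n => (x : ℕ → ℤ) (N + n)) (N := N)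
      (L := 0) (fun n => by simp [h (N + n) (by omega)]) t
    rw [hv, h2, sub_zero] at h1
    have := ENat.add_left_injective_of_ne_top (hfin t) h1
    exact_mod_cast this.symm
  have hconv : ∀ (z : ℕ → ℤ) t, Fintype.card {k : Fin N // z k = t} =
      ((Finset.range N).filter fun k => z k = t).card := fun z t => by
    rw [Fintype.card_subtype, Finset.card_filter, Finset.card_filter,
      Fin.sum_univ_eq_sum_range (fun k => if z k = t then 1 else 0)]
  obtain ⟨σ, hσ⟩ := exists_perm_comp_eq (f := fun k : Fin N => (x : ℕ → ℤ) k)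
    (g := fun k : Fin N => (y : ℕ → ℤ) k) (fun t => by rw [hconv, hconv, hcard])
  let e : Fin N ≃ {n // n < N} := Fin.equivSubtype
  refine ⟨Equiv.Perm.ofSubtype (p := fun n => n < N) (e.permCongr σ), ?_, ?_⟩
  · refine (Set.finite_lt_nat N).subset fun n hn => ?_
    by_contra hcon
    exact hn (Equiv.Perm.ofSubtype_apply_of_not_mem _ hcon)
  · intro n
    rcases Nat.lt_or_ge n N with hn | hn
    · rw [Equiv.Perm.ofSubtype_apply_of_mem (p := fun n => n < N) _ hn]
      exact hσ ⟨n, hn⟩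
    · rw [Equiv.Perm.ofSubtype_apply_of_not_mem (p := fun n => n < N) _ (by omega), h n hn]

theorem ExchRel.symm {x y : walkShift} (h : ExchRel walkShift x y) : ExchRel walkShift y x := by
  obtain ⟨σ, hσ, h⟩ := h
  refine ⟨σ⁻¹, hσ.subset fun n hn h' => hn ?_, fun n => by simp [h]⟩
  rw [Equiv.Perm.inv_eq_iff_eq, h']

theorem ExchRel.visits_eq {x y : walkShift} (h : ExchRel walkShift x y) (t : ℤ) :
    visits t (y : ℕ → ℤ) = visits t (x : ℕ → ℤ) := by
  obtain ⟨σ, -, hσ⟩ := h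
  unfold visits
  rw [show {n | (y : ℕ → ℤ) n = t} = σ ⁻¹' {n | (x : ℕ → ℤ) n = t} by ext n; simp [hσ]]
  rw [← Equiv.image_symm_eq_preimage, σ.symm.injective.encard_image]

theorem ExchRel.mem_twiceVisited {x y : walkShift} (h : ExchRel walkShift x y)
    (hx : x ∈ twiceVisited) : y ∈ twiceVisited :=
  ⟨fun s hs => by rw [h.visits_eq, hx.1 s hs], fun s hs => by rw [h.visits_eq, hx.2 s hs]⟩

theorem ExchRel.exists_eventually_eq {x y : walkShift} (h : ExchRel walkShift x y) :
    ∃ N, ∀ n, N ≤ n → (x : ℕ → ℤ) n = (y : ℕ → ℤ) n := by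
  obtain ⟨σ, hfin, hσ⟩ := h
  obtain ⟨N, hN⟩ := hfin.bddAbove
  refine ⟨N + 1, fun n hn => ?_⟩
  rw [hσ]
  by_contra hcon
  have : n ∈ {n | σ n ≠ n} := fun h => hcon (by rw [h])
  have := hN this
  omega

/-- The point of the walk shift coded by `ω` with index `s`. -/
def code (s : ℕ) (ω : ℕ → Fin 2) : walkShift := ⟨codeSeq s ω, (isTwicePath_codeSeq s ω).step⟩

theorem isTwicePath_code (s : ℕ) (ω : ℕ → Fin 2) : IsTwicePath (code s ω : ℕ → ℤ) :=
  isTwicePath_codeSeq s ω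

theorem code_mem_twiceVisited (s : ℕ) (ω : ℕ → Fin 2) : code s ω ∈ twiceVisited :=
  isTwicePath_iff.1 (isTwicePath_code s ω)

theorem exists_code {x : walkShift} (hx : x ∈ twiceVisited) : ∃ s ω, code s ω = x := by
  obtain ⟨s, ω, h⟩ := (isTwicePath_iff.2 hx).exists_codeSeq
  exact ⟨s, ω, Subtype.ext h⟩

theorem code_inj {s s' : ℕ} {ω ω' : ℕ → Fin 2} (h : code s ω = code s' ω') : s = s' ∧ ω = ω' :=
  codeSeq_inj (congrArg Subtype.val h)

theorem exchRel_code {s s' : ℕ} {u u' : List (Fin 2)}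
    (h : startLevel s + weight u = startLevel s' + weight u') (ω : ℕ → Fin 2) :
    ExchRel walkShift (code s (prepend u ω)) (code s' (prepend u' ω)) := by
  refine exchRel_of_eventually_eq (isTwicePath_code _ _) (isTwicePath_code _ _)
    (N := 2 * (startLevel s + weight u)) fun n hn => ?_
  obtain ⟨k, rfl⟩ := Nat.exists_eq_add_of_le hn
  change codeSeq _ _ _ = codeSeq _ _ _
  rw [codeSeq_tail]
  conv_rhs => rw [h]
  rw [codeSeq_tail, h]

/-- The partial sums of the letters either hit `k` or jump over it, and a jump needs the letter 2.
-/
theorem exists_prepend_weight (k : ℕ) (ω : ℕ → Fin 2) :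
    (∃ u η, prepend u η = ω ∧ weight u = k) ∨
      ∃ u η, prepend u (consSeq 1 η) = ω ∧ weight u + 1 = k := by
  induction k with
  | zero => exact Or.inl ⟨[], ω, rfl, rfl⟩
  | succ k ih =>
    rcases ih with ⟨u, η, rfl, rfl⟩ | ⟨u, η, rfl, rfl⟩
    · rw [← consSeq_head_tail η]
      generalize η 0 = i
      fin_cases i
      · exact Or.inl ⟨u ++ [0], _, prepend_append u [0] _, by simp [weight_append, weight]⟩
      · exact Or.inr ⟨u, _, rfl, rfl⟩
    · exact Or.inl ⟨u ++ [1], η, prepend_append u [1] η, by simp [weight_append, weight]⟩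

theorem ExchRel.exists_prepend {s s' : ℕ} {ω ω' : ℕ → Fin 2}
    (h : ExchRel walkShift (code s ω) (code s' ω')) :
    ∃ u u' η, prepend u η = ω ∧ prepend u' η = ω' ∧
      startLevel s + weight u = startLevel s' + weight u' := by
  obtain ⟨N, hN⟩ := h.exists_eventually_eq
  -- A prefix this heavy ends after time `N`, and at a height above the start level of the other
  -- code.
  obtain ⟨u, η, rfl, hu⟩ : ∃ u η, prepend u η = ω ∧ N + startLevel s' + 1 ≤ weight u := by
    rcases exists_prepend_weight (N + startLevel s' + 1) ω with ⟨u, η, h1, h2⟩ | ⟨u, η, h1, h2⟩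
    · exact ⟨u, η, h1, h2.ge⟩
    · exact ⟨u ++ [1], η, by rw [prepend_append]; exact h1, by
        simp [weight_append, weight]; omega⟩
  obtain ⟨k, hk⟩ : ∃ k, startLevel s + weight u = startLevel s' + k :=
    ⟨startLevel s + weight u - startLevel s', by omega⟩
  have htail : ∀ n, codeSeq s' ω' (2 * (startLevel s' + k) + n) =
      (startLevel s' + k : ℕ) + blockPath η n := fun n => by
    rw [← hk, ← codeSeq_tail]
    exact (hN _ (by omega)).symm
  rcases exists_prepend_weight k ω' with ⟨u', η', rfl, rfl⟩ | ⟨u', η', rfl, rfl⟩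
  · obtain rfl : η' = η := blockPath_injective (funext fun n => by
      have := htail n
      rw [codeSeq_tail] at this
      linarith)
    exact ⟨u, u', η', rfl, rfl, hk⟩
  · exfalso
    -- Here the cut would fall inside a block `1, 2, 1, 2`. Its third entry returns to the lower
    -- level, but the common tail starts one level higher.
    have h1 := htail 0
    rw [show 2 * (startLevel s' + (weight u' + 1)) + 0 = 2 * (startLevel s' + weight u') + 2 by ring,
      codeSeq_tail, blockPath_consSeq_one, blockPath_zero η] at h1
    simp at h1

/-! ### The golden-mean product measure -/

theorem goldenP_pos : 0 < goldenP := by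
  have h := goldenP_add_sq
  have h' := goldenP_nonneg
  rcases h'.lt_or_eq with h1 | h1
  · exact h1
  · rw [← h1] at h; norm_num at h

theorem goldenP_lt_one : goldenP < 1 := by
  have h := goldenP_add_sq
  have h' := goldenP_pos
  nlinarith

/-- The golden-mean number as an extended nonnegative real. -/
noncomputable def goldenE : ℝ≥0∞ := ENNReal.ofReal goldenP

theorem goldenE_lt_one : goldenE < 1 := ENNReal.ofReal_lt_one.2 goldenP_lt_one

theorem goldenE_ne_top : goldenE ≠ ∞ := ENNReal.ofReal_ne_top

theorem goldenLetter_eq :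
    goldenLetter = goldenE • Measure.dirac 0 + goldenE ^ 2 • Measure.dirac 1 := by
  rw [goldenLetter, goldenE, ENNReal.ofReal_pow goldenP_nonneg]

instance isProbabilityMeasure_goldenMeasure : IsProbabilityMeasure goldenMeasure :=
  inferInstanceAs (IsProbabilityMeasure (Measure.infinitePi _))

theorem measurable_consSeq (i : Fin 2) : Measurable (consSeq i) :=
  measurable_pi_lambda _ fun n => by
    cases n with
    | zero => exact measurable_const
    | succ n => exact measurable_pi_apply n

theorem measurable_prepend (u : List (Fin 2)) : Measurable (prepend u) := by
  induction u with
  | nil => exact measurable_id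
  | cons i u ih => exact (measurable_consSeq i).comp ih

/-- By the Lusin–Souslin theorem a measurable injection from a standard Borel space into a countably
separated one is an embedding; this is what makes images under the codings measurable. -/
theorem measurableEmbedding_prepend (u : List (Fin 2)) : MeasurableEmbedding (prepend u) :=
  (measurable_prepend u).measurableEmbedding (prepend_injective u)

theorem preimage_consSeq_pi_range (i : Fin 2) (n : ℕ) (t : ℕ → Set (Fin 2)) :
    consSeq i ⁻¹' (Set.pi (Finset.range (n + 1)) t) =
      {_ω | i ∈ t 0} ∩ Set.pi (Finset.range n) fun k => t (k + 1) := by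
  ext ω
  simp only [mem_preimage, Set.mem_pi, Finset.coe_range, mem_Iio, mem_inter_iff, mem_ofPred_eq]
  constructor
  · exact fun h => ⟨h 0 (by omega), fun k hk => h (k + 1) (by omega)⟩
  · rintro ⟨h0, h⟩ k hk
    cases k with
    | zero => exact h0
    | succ k => exact h k (by omega)

/-- The golden-mean measure is self-similar. -/
theorem goldenMeasure_eq_add : goldenMeasure =
    goldenE • goldenMeasure.map (consSeq 0) + goldenE ^ 2 • goldenMeasure.map (consSeq 1) := by
  symm
  refine Measure.eq_infinitePi _ fun s t ht => ?_
  obtain ⟨n, hn⟩ : ∃ n, s ⊆ Finset.range (n + 1) :=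
    ⟨s.sup id, fun k hk => Finset.mem_range.2 (Nat.lt_succ_of_le (Finset.le_sup (f := id) hk))⟩
  classical
  -- Padding with `univ` turns the box into one over an initial segment of coordinates, from which
  -- the first coordinate can be split off.
  set t' : ℕ → Set (Fin 2) := fun k => if k ∈ s then t k else univ with ht'
  have hmt' : ∀ k, MeasurableSet (t' k) := fun k => MeasurableSet.of_discrete
  have h1 : Set.pi (s : Set ℕ) t = Set.pi (Finset.range (n + 1)) t' := by
    ext ω
    simp only [Set.mem_pi, Finset.mem_coe, ht']
    constructor
    · intro h k _
      split_ifs with hk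
      · exact h k hk
      · trivial
    · intro h k hk
      simpa [hk] using h k (hn hk)
  have h2 : ∏ k ∈ s, goldenLetter (t k) = ∏ k ∈ Finset.range (n + 1), goldenLetter (t' k) := by
    rw [← Finset.prod_subset hn]
    · exact Finset.prod_congr rfl fun k hk => by simp [ht', hk]
    · intro k _ hk
      simp [ht', hk]
  have hbox : MeasurableSet (Set.pi (Finset.range (n + 1) : Set ℕ) t') :=
    MeasurableSet.pi (Finset.countable_toSet _) fun k _ => hmt' k
  have hpi : goldenMeasure (Set.pi (Finset.range n) fun k => t' (k + 1)) =
      ∏ k ∈ Finset.range n, goldenLetter (t' (k + 1)) :=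
    Measure.infinitePi_pi _ fun k _ => hmt' (k + 1)
  have hval : ∀ i : Fin 2, goldenMeasure (consSeq i ⁻¹' (Set.pi (Finset.range (n + 1)) t')) =
      Measure.dirac i (t' 0) * ∏ k ∈ Finset.range n, goldenLetter (t' (k + 1)) := fun i => by
    rw [preimage_consSeq_pi_range, Measure.dirac_apply' _ (hmt' 0)]
    by_cases hi : i ∈ t' 0 <;> simp [hi, ← hpi]
  rw [h1, h2, Finset.prod_range_succ', Measure.add_apply, Measure.smul_apply, Measure.smul_apply,
    Measure.map_apply (measurable_consSeq 0) hbox, Measure.map_apply (measurable_consSeq 1) hbox,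
    hval, hval, goldenLetter_eq]
  simp only [Measure.add_apply, Measure.smul_apply, smul_eq_mul]
  ring

theorem goldenMeasure_apply {E : Set (ℕ → Fin 2)} (hE : MeasurableSet E) :
    goldenMeasure E = goldenE * goldenMeasure (consSeq 0 ⁻¹' E) +
      goldenE ^ 2 * goldenMeasure (consSeq 1 ⁻¹' E) := by
  conv_lhs => rw [goldenMeasure_eq_add]
  rw [Measure.add_apply, Measure.smul_apply, Measure.smul_apply,
    Measure.map_apply (measurable_consSeq 0) hE, Measure.map_apply (measurable_consSeq 1) hE]
  rfl

theorem goldenMeasure_image_consSeq (i : Fin 2) {D : Set (ℕ → Fin 2)} (hD : MeasurableSet D) :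
    goldenMeasure (consSeq i '' D) = goldenE ^ ((i : ℕ) + 1) * goldenMeasure D := by
  have hE : MeasurableSet (consSeq i '' D) :=
    (measurableEmbedding_prepend [i]).measurableSet_image.2 hD
  have hne : ∀ j, j ≠ i → consSeq j ⁻¹' (consSeq i '' D) = ∅ := fun j hj => by
    rw [eq_empty_iff_forall_notMem]
    rintro ω ⟨η, -, h⟩
    exact hj (congrFun h 0).symm
  rw [goldenMeasure_apply hE]
  fin_cases i
  · rw [hne 1 (by decide)]
    simp [preimage_image_eq _ (consSeq_injective 0)]
  · rw [hne 0 (by decide)]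
    simp [preimage_image_eq _ (consSeq_injective 1)]

theorem goldenMeasure_image_prepend (u : List (Fin 2)) {D : Set (ℕ → Fin 2)}
    (hD : MeasurableSet D) :
    goldenMeasure (prepend u '' D) = goldenE ^ weight u * goldenMeasure D := by
  induction u with
  | nil => simp [prepend, weight]
  | cons i u ih =>
    have h : prepend (i :: u) '' D = consSeq i '' (prepend u '' D) := by
      rw [image_image]; rfl
    rw [h, goldenMeasure_image_consSeq i ((measurableEmbedding_prepend u).measurableSet_image.2 hD),
      ih, weight, pow_add _ _ (weight u), mul_assoc]

/-- Each letter of `ω` contributes a factor at most $p<1$. -/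
theorem goldenMeasure_singleton (ω : ℕ → Fin 2) : goldenMeasure {ω} = 0 := by
  have key : ∀ n : ℕ, ∀ ω, goldenMeasure {ω} ≤ goldenE ^ n := by
    intro n
    induction n with
    | zero => intro ω; simpa using prob_le_one
    | succ n ih =>
      intro ω
      have h : ({ω} : Set (ℕ → Fin 2)) = consSeq (ω 0) '' {fun k => ω (k + 1)} := by
        rw [image_singleton, consSeq_head_tail]
      rw [h, goldenMeasure_image_consSeq _ (measurableSet_singleton _), pow_succ' goldenE n]
      refine mul_le_mul' ?_ (ih _)
      exact (pow_le_pow_of_le_one zero_le goldenE_lt_one.le (by omega : 1 ≤ (ω 0 : ℕ) + 1)).trans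
        (pow_one _).le
  have hlim := ENNReal.tendsto_pow_atTop_nhds_zero_of_lt_one goldenE_lt_one
  exact le_antisymm (ge_of_tendsto' hlim fun n => key n ω) zero_le

/-! ### Measures are determined by their values on words -/

theorem exists_range_prepend_eq_cylinder (n : ℕ) (ω : ℕ → Fin 2) :
    ∃ u, range (prepend u) = PiNat.cylinder ω n := by
  induction n generalizing ω with
  | zero =>
    refine ⟨[], ?_⟩
    rw [PiNat.cylinder_zero]
    exact range_id
  | succ n ih =>
    obtain ⟨u, hu⟩ := ih fun k => ω (k + 1)
    refine ⟨ω 0 :: u, ?_⟩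
    ext η
    have h1 : η ∈ range (prepend (ω 0 :: u)) ↔
        η 0 = ω 0 ∧ (fun k => η (k + 1)) ∈ range (prepend u) := by
      constructor
      · rintro ⟨ζ, rfl⟩
        exact ⟨rfl, ζ, rfl⟩
      · rintro ⟨h0, ζ, h⟩
        exact ⟨ζ, by rw [prepend, h, ← h0, consSeq_head_tail]⟩
    rw [h1, hu, PiNat.mem_cylinder_iff, PiNat.mem_cylinder_iff]
    constructor
    · rintro ⟨h0, h⟩ k hk
      cases k with
      | zero => exact h0
      | succ k => exact h k (by omega)
    · exact fun h => ⟨h 0 (by omega), fun k hk => h (k + 1) (by omega)⟩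

theorem ext_of_range_prepend {μ₁ μ₂ : Measure (ℕ → Fin 2)} [IsFiniteMeasure μ₁]
    (h : ∀ u, μ₁ (range (prepend u)) = μ₂ (range (prepend u))) : μ₁ = μ₂ := by
  have hb := PiNat.isTopologicalBasis_cylinders fun _ : ℕ => Fin 2
  refine ext_of_generate_finite {s | ∃ (x : ℕ → Fin 2) (n : ℕ), s = PiNat.cylinder x n}
    ?_ ?_ ?_ ?_
  · rw [← hb.borel_eq_generateFrom]
    exact BorelSpace.measurable_eq
  · rintro _ ⟨x, n, rfl⟩ _ ⟨y, k, rfl⟩ ⟨z, hz1, hz2⟩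
    rw [PiNat.mem_cylinder_iff_eq] at hz1 hz2
    rw [← hz1, ← hz2]
    rcases le_total n k with hnk | hnk
    · exact ⟨z, k, inter_eq_right.2 (PiNat.cylinder_anti z hnk)⟩
    · exact ⟨z, n, inter_eq_left.2 (PiNat.cylinder_anti z hnk)⟩
  · rintro _ ⟨x, n, rfl⟩
    obtain ⟨u, hu⟩ := exists_range_prepend_eq_cylinder n x
    rw [← hu, h]
  · simpa [prepend] using h []

theorem goldenMeasure_range_prepend (u : List (Fin 2)) :
    goldenMeasure (range (prepend u)) = goldenE ^ weight u := by
  rw [← image_univ, goldenMeasure_image_prepend u MeasurableSet.univ, measure_univ, mul_one]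

/-- A bounded geometric sequence with ratio of absolute value greater than `1` is zero. -/
theorem eq_zero_of_bounded_geometric {d : ℕ → ℝ} {r C : ℝ} (hr : 1 < |r|)
    (hd : ∀ n, d (n + 1) = r * d n) (hC : ∀ n, |d n| ≤ C) (n : ℕ) : d n = 0 := by
  have hpow : ∀ n, d n = r ^ n * d 0 := fun n => by
    induction n with
    | zero => simp
    | succ n ih => rw [hd, ih]; ring
  have h0 : d 0 = 0 := by
    by_contra hne
    obtain ⟨n, hn⟩ := pow_unbounded_of_one_lt (C / |d 0|) hr
    have h1 := hC n
    rw [hpow, abs_mul, abs_pow] at h1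
    rw [div_lt_iff₀ (abs_pos.2 hne)] at hn
    linarith
  rw [hpow, h0, mul_zero]

theorem weight_replicate_zero (k : ℕ) : weight (List.replicate k 0) = k := by
  induction k with
  | zero => rfl
  | succ k ih => rw [List.replicate_succ, weight, ih]; simp [add_comm]

theorem preimage_consSeq_preimage_prepend (i : Fin 2) (u : List (Fin 2)) (A : Set (ℕ → Fin 2)) :
    consSeq i ⁻¹' (prepend u ⁻¹' A) = prepend (u ++ [i]) ⁻¹' A := by
  ext ω
  simp [prepend_append, prepend]

/-- Zero-one law: a set that is invariant under the exchange of initial words of equal weight is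
null or co-null. -/
theorem goldenMeasure_zero_or_one {A : Set (ℕ → Fin 2)} (hA : MeasurableSet A)
    (hinv : ∀ u u' η, weight u = weight u' → prepend u η ∈ A → prepend u' η ∈ A) :
    goldenMeasure A = 0 ∨ goldenMeasure A = 1 := by
  have hpre : ∀ u u', weight u = weight u' → prepend u ⁻¹' A = prepend u' ⁻¹' A :=
    fun u u' h => Subset.antisymm (fun η => hinv u u' η h) (fun η => hinv u' u η h.symm)
  set f : ℕ → ℝ := fun k => goldenMeasure.real (prepend (List.replicate k 0) ⁻¹' A) with hf
  have hfu : ∀ u, goldenMeasure.real (prepend u ⁻¹' A) = f (weight u) := fun u => by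
    rw [hf]
    dsimp only
    rw [hpre u (List.replicate (weight u) 0) (weight_replicate_zero _).symm]
  -- Self-similarity of the measure, split according to the letter that follows the word.
  have hrec : ∀ k, f k = goldenP * f (k + 1) + goldenP ^ 2 * f (k + 2) := fun k => by
    have h := congrArg ENNReal.toReal
      (goldenMeasure_apply (measurable_prepend (List.replicate k 0) hA))
    rw [ENNReal.toReal_add (ENNReal.mul_ne_top goldenE_ne_top (measure_ne_top _ _))
      (ENNReal.mul_ne_top (ENNReal.pow_ne_top goldenE_ne_top) (measure_ne_top _ _)),
      ENNReal.toReal_mul, ENNReal.toReal_mul, ENNReal.toReal_pow, goldenE,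
      ENNReal.toReal_ofReal goldenP_nonneg, preimage_consSeq_preimage_prepend,
      preimage_consSeq_preimage_prepend] at h
    have h0 := hfu (List.replicate k 0 ++ [0])
    have h1 := hfu (List.replicate k 0 ++ [1])
    simp only [weight_append, weight_replicate_zero, weight] at h0 h1
    norm_num at h0 h1
    rw [← h0, ← h1]
    exact h
  have hbd : ∀ k, 0 ≤ f k ∧ f k ≤ 1 := fun k => ⟨measureReal_nonneg, measureReal_le_one⟩
  have hp := goldenP_pos
  have hp1 := goldenP_lt_one
  have hpq := goldenP_add_sq
  -- By $p+p^2=1$ the increments are multiplied by $-1/p^2$ at each step, so boundedness forces them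
  -- to vanish.
  have hconst : ∀ k, f (k + 1) - f k = 0 := by
    refine eq_zero_of_bounded_geometric (r := -(1 / goldenP ^ 2)) (C := 1) ?_ (fun k => ?_)
      fun k => ?_
    · rw [abs_neg, abs_of_pos (by positivity), one_lt_div (by positivity)]
      nlinarith
    · have := hrec k
      field_simp
      have h2 : f (k + 1) * (goldenP + goldenP ^ 2) = f (k + 1) := by rw [hpq, mul_one]
      rw [add_assoc]
      linarith
    · have := hbd k
      have := hbd (k + 1)
      rw [abs_le]
      constructor <;> linarith
  have hf0 : ∀ k, f k = f 0 := fun k => by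
    induction k with
    | zero => rfl
    | succ k ih => have := hconst k; linarith
  have hm : ∀ u, goldenMeasure (prepend u ⁻¹' A) = goldenMeasure A := fun u => by
    have h : goldenMeasure.real (prepend u ⁻¹' A) = goldenMeasure.real (prepend [] ⁻¹' A) := by
      rw [hfu, hfu, hf0, hf0 (weight [])]
    exact (ENNReal.toReal_eq_toReal_iff' (measure_ne_top _ _) (measure_ne_top _ _)).1 h
  -- `A` is independent of every cylinder; evaluating at `A` itself gives $m(A)=m(A)^2$.
  have heq : goldenMeasure.restrict A = goldenMeasure A • goldenMeasure := by
    refine ext_of_range_prepend fun u => ?_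
    rw [Measure.restrict_apply (measurableEmbedding_prepend u).measurableSet_range,
      Measure.smul_apply, goldenMeasure_range_prepend, inter_comm, ← image_preimage_eq_inter_range,
      goldenMeasure_image_prepend u (measurable_prepend u hA), hm, smul_eq_mul, mul_comm]
  have hsq := congrArg (fun μ : Measure (ℕ → Fin 2) => μ A) heq
  simp only [Measure.restrict_apply hA, inter_self, Measure.smul_apply, smul_eq_mul] at hsq
  by_cases h0 : goldenMeasure A = 0
  · exact Or.inl h0
  · refine Or.inr ((ENNReal.mul_right_inj h0 (measure_ne_top _ _)).1 ?_)
    rw [← hsq, mul_one]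

theorem range_prepend_eq_union (u : List (Fin 2)) :
    range (prepend u) = range (prepend (u ++ [0])) ∪ range (prepend (u ++ [1])) := by
  ext ω
  simp only [mem_range, mem_union, prepend_append, prepend]
  constructor
  · rintro ⟨η, rfl⟩
    rw [← consSeq_head_tail η]
    generalize η 0 = i
    fin_cases i
    · exact Or.inl ⟨_, rfl⟩
    · exact Or.inr ⟨_, rfl⟩
  · rintro (⟨η, rfl⟩ | ⟨η, rfl⟩) <;> exact ⟨_, rfl⟩

/-- The golden-mean measure is the only probability measure that gives the same mass to words of
equal weight. -/
theorem eq_goldenMeasure {μ : Measure (ℕ → Fin 2)} [IsProbabilityMeasure μ]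
    (h : ∀ u u', weight u = weight u' → μ (range (prepend u)) = μ (range (prepend u'))) :
    μ = goldenMeasure := by
  set q : ℕ → ℝ := fun k => μ.real (range (prepend (List.replicate k 0))) with hq
  have hqu : ∀ u, μ.real (range (prepend u)) = q (weight u) := fun u =>
    congrArg ENNReal.toReal (h _ _ (weight_replicate_zero _).symm)
  have hrec : ∀ k, q k = q (k + 1) + q (k + 2) := fun k => by
    have h0 := hqu (List.replicate k 0 ++ [0])
    have h1 := hqu (List.replicate k 0 ++ [1])
    simp only [weight_append, weight_replicate_zero, weight] at h0 h1
    norm_num at h0 h1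
    rw [← h0, ← h1, ← measureReal_union _ (measurableEmbedding_prepend _).measurableSet_range,
      ← range_prepend_eq_union]
    rw [Set.disjoint_left]
    rintro _ ⟨η, rfl⟩ ⟨ζ, hζ⟩
    rw [prepend_append, prepend_append] at hζ
    exact absurd (congrFun (prepend_injective _ hζ) 0) (by simp [prepend, consSeq])
  have hbd : ∀ k, 0 ≤ q k ∧ q k ≤ 1 := fun k => ⟨measureReal_nonneg, measureReal_le_one⟩
  have hp := goldenP_pos
  have hp1 := goldenP_lt_one
  have hpq := goldenP_add_sq
  -- The characteristic roots of the recursion are $p$ and $-(1+p)$. This combination removes the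
  -- first, and boundedness excludes the second.
  have hgeo : ∀ k, q (k + 1) - goldenP * q k = 0 := by
    refine eq_zero_of_bounded_geometric (r := -(1 + goldenP)) (C := 1) ?_ (fun k => ?_)
      fun k => ?_
    · rw [abs_neg, abs_of_pos (by positivity)]
      linarith
    · have h1 := hrec k
      have h2 : q k * (goldenP + goldenP ^ 2) = q k := by rw [hpq, mul_one]
      nlinarith
    · have := hbd k
      have := hbd (k + 1)
      rw [abs_le]
      constructor <;> nlinarith
  have hqk : ∀ k, q k = goldenP ^ k := fun k => by
    induction k with
    | zero => simp [hq, prepend]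
    | succ k ih => have := hgeo k; rw [pow_succ', ← ih]; linarith
  refine ext_of_range_prepend fun u => ?_
  rw [goldenMeasure_range_prepend, goldenE, ← ENNReal.ofReal_pow goldenP_nonneg, ← hqk, ← hqu,
    ofReal_measureReal]

/-! ### Measurability of the coding -/

theorem measurable_blockPath_apply (n : ℕ) : Measurable fun ω => blockPath ω n := by
  have hshift : Measurable fun (ω : ℕ → Fin 2) (k : ℕ) => ω (k + 1) :=
    measurable_pi_lambda _ fun k => measurable_pi_apply (k + 1)
  have h0 : MeasurableSet {ω : ℕ → Fin 2 | ω 0 = 0} :=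
    measurableSet_eq_fun (measurable_pi_apply 0) measurable_const
  induction n using Nat.strong_induction_on with
  | _ n ih =>
    have e : (fun ω => blockPath ω n) = fun ω : ℕ → Fin 2 =>
        if ω 0 = 0 then
          if n < 2 then 1 else 1 + blockPath (fun k => ω (k + 1)) (n - 2)
        else
          if n < 4 then (if n % 2 = 0 then 1 else 2)
          else 2 + blockPath (fun k => ω (k + 1)) (n - 4) := by
      funext ω
      rw [blockPath]
    rw [e]
    refine Measurable.ite h0 ?_ ?_
    · by_cases h : n < 2
      · simp only [if_pos h]; exact measurable_const
      · simp only [if_neg h]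
        exact ((ih (n - 2) (by omega)).comp hshift).const_add 1
    · by_cases h : n < 4
      · simp only [if_pos h]; exact measurable_const
      · simp only [if_neg h]
        exact ((ih (n - 4) (by omega)).comp hshift).const_add 2

theorem measurable_code (s : ℕ) : Measurable (code s) := by
  refine Measurable.subtype_mk (measurable_pi_lambda _ fun n => ?_)
  unfold codeSeq
  split_ifs
  · exact measurable_const
  · exact measurable_const
  · exact (measurable_blockPath_apply _).const_add _

theorem measurableEmbedding_code (s : ℕ) : MeasurableEmbedding (code s) :=
  (measurable_code s).measurableEmbedding fun _ _ h => (code_inj h).2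

/-- The points of `Z` whose code has index `s` and begins with the word `u`. -/
def codeWord (s : ℕ) (u : List (Fin 2)) (ω : ℕ → Fin 2) : walkShift := code s (prepend u ω)

theorem measurableEmbedding_codeWord (s : ℕ) (u : List (Fin 2)) :
    MeasurableEmbedding (codeWord s u) :=
  (measurableEmbedding_code s).comp (measurableEmbedding_prepend u)

theorem twiceVisited_eq_iUnion : twiceVisited = ⋃ s, range (code s) := by
  ext x
  simp only [mem_iUnion, mem_range]
  exact ⟨exists_code, fun ⟨s, ω, h⟩ => h ▸ code_mem_twiceVisited s ω⟩

theorem measurableSet_twiceVisited : MeasurableSet twiceVisited := by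
  rw [twiceVisited_eq_iUnion]
  exact MeasurableSet.iUnion fun s => (measurableEmbedding_code s).measurableSet_range

theorem measurableSet_cyl (s : ℤ) : MeasurableSet (cyl walkShift s) :=
  measurableSet_eq_fun ((measurable_pi_apply 0).comp measurable_subtype_coe) measurable_const

theorem code_mem_cyl_one_iff {s : ℕ} {ω : ℕ → Fin 2} : code s ω ∈ cyl walkShift 1 ↔ s = 0 := by
  change codeSeq s ω 0 = 1 ↔ s = 0
  rw [codeSeq_apply_zero]
  split_ifs with h
  · simp [h]
  · simp

theorem cyl_one_inter_twiceVisited : cyl walkShift 1 ∩ twiceVisited = range (code 0) := by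
  ext x
  constructor
  · rintro ⟨h1, h2⟩
    obtain ⟨s, ω, rfl⟩ := exists_code h2
    obtain rfl := code_mem_cyl_one_iff.1 h1
    exact ⟨ω, rfl⟩
  · rintro ⟨ω, rfl⟩
    exact ⟨code_mem_cyl_one_iff.2 rfl, code_mem_twiceVisited 0 ω⟩

/-! ### The exchangeable measure on `Z` -/

/-- The exchangeable measure carried by `Z`: on the part of `Z` that is coded with index `s`, it is
the image of the golden-mean measure with weight `p ^ startLevel s`. -/
noncomputable def exchMeasure : Measure walkShift :=
  Measure.sum fun s => goldenE ^ startLevel s • goldenMeasure.map (code s)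

theorem exchMeasure_apply {E : Set walkShift} (hE : MeasurableSet E) :
    exchMeasure E = ∑' s, goldenE ^ startLevel s * goldenMeasure (code s ⁻¹' E) := by
  rw [exchMeasure, Measure.sum_apply _ hE]
  refine tsum_congr fun s => ?_
  rw [Measure.smul_apply, Measure.map_apply (measurable_code s) hE, smul_eq_mul]

instance isFiniteMeasure_exchMeasure : IsFiniteMeasure exchMeasure := by
  constructor
  rw [exchMeasure_apply MeasurableSet.univ]
  have h : ∑' s, goldenE ^ startLevel s * goldenMeasure (code s ⁻¹' univ) ≤
      ∑' s : ℕ, goldenE ^ s := by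
    refine ENNReal.tsum_le_tsum fun s => ?_
    rw [preimage_univ, measure_univ, mul_one]
    refine pow_le_pow_of_le_one zero_le goldenE_lt_one.le ?_
    unfold startLevel
    split_ifs <;> omega
  refine h.trans_lt ?_
  rw [ENNReal.tsum_geometric]
  exact ENNReal.inv_lt_top.2 (tsub_pos_of_lt goldenE_lt_one)

theorem exchMeasure_image_codeWord (s : ℕ) (u : List (Fin 2)) {D : Set (ℕ → Fin 2)}
    (hD : MeasurableSet D) : exchMeasure (codeWord s u '' D) =
      goldenE ^ (startLevel s + weight u) * goldenMeasure D := by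
  rw [exchMeasure_apply ((measurableEmbedding_codeWord s u).measurableSet_image.2 hD),
    tsum_eq_single s]
  · have h : codeWord s u '' D = code s '' (prepend u '' D) := by
      rw [image_image]; rfl
    rw [h, preimage_image_eq _ (measurableEmbedding_code s).injective,
      goldenMeasure_image_prepend u hD, pow_add, mul_assoc]
  · intro t ht
    have h : code t ⁻¹' (codeWord s u '' D) = ∅ := by
      rw [eq_empty_iff_forall_notMem]
      rintro ω ⟨η, -, h⟩
      exact ht (code_inj h).1.symm
    rw [h, measure_empty, mul_zero]

theorem exchMeasure_compl_twiceVisited : exchMeasure twiceVisitedᶜ = 0 := by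
  rw [exchMeasure_apply measurableSet_twiceVisited.compl, ENNReal.tsum_eq_zero]
  intro s
  have h : code s ⁻¹' twiceVisitedᶜ = ∅ := by
    rw [eq_empty_iff_forall_notMem]
    exact fun ω h => h (code_mem_twiceVisited s ω)
  rw [h, measure_empty, mul_zero]

theorem exchMeasure_restrict_cyl_one :
    exchMeasure.restrict (cyl walkShift 1) = goldenMeasure.map (code 0) := by
  ext E hE
  rw [Measure.restrict_apply hE, exchMeasure_apply (hE.inter (measurableSet_cyl 1)),
    tsum_eq_single 0, Measure.map_apply (measurable_code 0) hE]
  · have h : code 0 ⁻¹' (E ∩ cyl walkShift 1) = code 0 ⁻¹' E := by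
      ext ω
      simp [code_mem_cyl_one_iff]
    rw [h]
    simp [startLevel]
  · intro s hs
    have h : code s ⁻¹' (E ∩ cyl walkShift 1) = ∅ := by
      rw [eq_empty_iff_forall_notMem]
      exact fun ω h => hs (code_mem_cyl_one_iff.1 h.2)
    rw [h, measure_empty, mul_zero]

theorem exchMeasure_cyl_one : exchMeasure (cyl walkShift 1) = 1 := by
  rw [← Measure.restrict_apply_univ, exchMeasure_restrict_cyl_one,
    Measure.map_apply (measurable_code 0) MeasurableSet.univ, preimage_univ, measure_univ]

theorem isAlphaFinite_exchMeasure : IsAlphaFinite exchMeasure :=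
  ⟨inferInstance, fun _ => measure_lt_top _ _⟩

/-- The domain of a holonomy is covered by the complement of $Z$, which is null, and countably many
pieces, one for each pair of prefixes of equal height, on which `κ` replaces one prefix by the
other. Such a replacement preserves the measure because the mass of a prefix depends only on its
height. -/
theorem isInvariant_exchMeasure : IsInvariant (ExchRel walkShift) exchMeasure := by
  intro A B κ hκ C hC
  have hA : MeasurableEmbedding (Subtype.val : A → walkShift) :=
    MeasurableEmbedding.subtype_coe hκ.measurableSet_dom
  have hB : MeasurableEmbedding (fun a : A => (κ a : walkShift)) :=
    (MeasurableEmbedding.subtype_coe hκ.measurableSet_im).comp κ.measurableEmbedding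
  let ι := {i : (ℕ × List (Fin 2)) × (ℕ × List (Fin 2)) //
    startLevel i.1.1 + weight i.1.2 = startLevel i.2.1 + weight i.2.2}
  let Q : Option ι → Set A := fun o => o.elim {a | (a : walkShift) ∉ twiceVisited} fun i =>
    {a | ∃ ω, codeWord i.1.1.1 i.1.1.2 ω = a ∧ codeWord i.1.2.1 i.1.2.2 ω = κ a}
  have hQ : ⋃ o, Q o = univ := by
    refine eq_univ_of_forall fun a => mem_iUnion.2 ?_
    by_cases ha : (a : walkShift) ∈ twiceVisited
    · obtain ⟨s, ω, h1⟩ := exists_code ha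
      obtain ⟨s', ω', h2⟩ := exists_code ((hκ.rel a).mem_twiceVisited ha)
      have hr := hκ.rel a
      rw [← h1, ← h2] at hr
      obtain ⟨u, u', η, rfl, rfl, hl⟩ := hr.exists_prepend
      exact ⟨some ⟨⟨⟨s, u⟩, ⟨s', u'⟩⟩, hl⟩, η, h1, h2⟩
    · exact ⟨none, ha⟩
  have hmain : Measure.comap (fun a : A => (κ a : walkShift)) exchMeasure =
      Measure.comap Subtype.val exchMeasure := by
    refine (Measure.ext_iff_of_iUnion_eq_univ hQ).2 fun o => ?_
    ext D hD
    rw [Measure.restrict_apply hD, Measure.restrict_apply hD, hA.comap_apply, hB.comap_apply]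
    cases o with
    | none =>
      rw [measure_mono_null _ exchMeasure_compl_twiceVisited,
        measure_mono_null _ exchMeasure_compl_twiceVisited]
      · rintro _ ⟨a, ha, rfl⟩
        exact ha.2
      · rintro _ ⟨a, ha, rfl⟩ hmem
        exact ha.2 ((hκ.rel a).symm.mem_twiceVisited hmem)
    | some i =>
      obtain ⟨⟨⟨s, u⟩, ⟨s', u'⟩⟩, hl⟩ := i
      have he := measurableEmbedding_codeWord s u
      have he' := measurableEmbedding_codeWord s' u'
      -- The existential in `Q` defines a projection; the measurable left inverse of the embedding
      -- supplies the only possible witness, leaving equalities of measurable maps.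
      have hQm : MeasurableSet {a : A | codeWord s u (he.invFun a) = a ∧
          codeWord s' u' (he.invFun a) = κ a} :=
        (measurableSet_eq_fun (he.measurable.comp (he.measurable_invFun.comp hA.measurable))
          hA.measurable).inter
        (measurableSet_eq_fun (he'.measurable.comp (he.measurable_invFun.comp hA.measurable))
          hB.measurable)
      have hQe : Q (some ⟨⟨⟨s, u⟩, ⟨s', u'⟩⟩, hl⟩) = {a : A | codeWord s u (he.invFun a) = a ∧
          codeWord s' u' (he.invFun a) = κ a} := by
        ext a
        constructor
        · rintro ⟨ω, h1, h2⟩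
          have : he.invFun (a : walkShift) = ω := by
            rw [← h1]
            exact he.leftInverse_invFun ω
          exact ⟨by rw [this]; exact h1, by rw [this]; exact h2⟩
        · exact fun h => ⟨_, h.1, h.2⟩
      have hE : MeasurableSet
          (codeWord s u ⁻¹' (Subtype.val '' (D ∩ Q (some ⟨⟨⟨s, u⟩, ⟨s', u'⟩⟩, hl⟩)))) :=
        he.measurable (hA.measurableSet_image.2 (hD.inter (hQe ▸ hQm)))
      have h1 : (Subtype.val '' (D ∩ Q (some ⟨⟨⟨s, u⟩, ⟨s', u'⟩⟩, hl⟩)) : Set walkShift) =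
          codeWord s u ''
          (codeWord s u ⁻¹' (Subtype.val '' (D ∩ Q (some ⟨⟨⟨s, u⟩, ⟨s', u'⟩⟩, hl⟩)))) := by
        rw [image_preimage_eq_of_subset]
        rintro _ ⟨a, ⟨-, ω, h, -⟩, rfl⟩
        exact ⟨ω, h⟩
      have h2 : (fun a : A => (κ a : walkShift)) '' (D ∩ Q (some ⟨⟨⟨s, u⟩, ⟨s', u'⟩⟩, hl⟩)) =
          codeWord s' u' ''
          (codeWord s u ⁻¹' (Subtype.val '' (D ∩ Q (some ⟨⟨⟨s, u⟩, ⟨s', u'⟩⟩, hl⟩)))) := by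
        ext x
        constructor
        · rintro ⟨a, ha, rfl⟩
          obtain ⟨ω, h, h'⟩ := ha.2
          exact ⟨ω, ⟨a, ha, h.symm⟩, h'⟩
        · rintro ⟨ω, ⟨a, ha, h⟩, rfl⟩
          obtain ⟨ω', h1, h2⟩ := ha.2
          rw [h] at h1
          obtain rfl := he.injective h1
          exact ⟨a, ha, h2.symm⟩
      rw [h2, exchMeasure_image_codeWord s' u' hE]
      refine Eq.trans ?_ (congrArg exchMeasure h1.symm)
      rw [exchMeasure_image_codeWord s u hE, hl]
  have h := congrArg (fun μ : Measure A => μ C) hmain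
  simp only [hA.comap_apply, hB.comap_apply] at h
  rw [image_image]
  exact h

/-- The opening descent and ascent can be exchanged for `startLevel s` blocks `1, 1`; thus every
class in $Z$ meets $[1]$, and questions about $Z$ reduce to index 0. -/
theorem exchRel_codeWord_replicate (s : ℕ) (ω : ℕ → Fin 2) :
    ExchRel walkShift (code s ω) (codeWord 0 (List.replicate (startLevel s) 0) ω) :=
  exchRel_code (u := []) (by simp [startLevel, weight, weight_replicate_zero]) ω

theorem isErgodic_exchMeasure : IsErgodic (ExchRel walkShift) exchMeasure := by
  have key : ∀ A : Set walkShift, MeasurableSet A →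
      (∀ x y, ExchRel walkShift x y → x ∈ A → y ∈ A) →
      goldenMeasure (code 0 ⁻¹' A) = 0 → exchMeasure A = 0 := by
    intro A hA hsat h0
    rw [exchMeasure_apply hA, ENNReal.tsum_eq_zero]
    intro s
    have hsub : prepend (List.replicate (startLevel s) 0) '' (code s ⁻¹' A) ⊆ code 0 ⁻¹' A := by
      rintro _ ⟨ω, hω, rfl⟩
      exact hsat _ _ (exchRel_codeWord_replicate s ω) hω
    have h := measure_mono_null hsub h0
    rwa [goldenMeasure_image_prepend _ (measurable_code s hA), weight_replicate_zero] at h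
  intro A hA hsat
  have hsat' : ∀ x y, ExchRel walkShift x y → x ∈ Aᶜ → y ∈ Aᶜ :=
    fun x y h hx hy => hx (hsat y x h.symm hy)
  rcases goldenMeasure_zero_or_one (measurable_code 0 hA) (fun u u' η h =>
    hsat _ _ (exchRel_code (by rw [h]) η)) with h | h
  · exact Or.inl (key A hA hsat h)
  · refine Or.inr (key Aᶜ hA.compl hsat' ?_)
    rwa [preimage_compl, prob_compl_eq_zero_iff (measurable_code 0 hA)]

/-- Replacing a prefix by another of the same height is itself a holonomy. -/
theorem IsInvariant.measure_image_codeWord {ν : Measure walkShift}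
    (hν : IsInvariant (ExchRel walkShift) ν) {s s' : ℕ} {u u' : List (Fin 2)}
    (h : startLevel s + weight u = startLevel s' + weight u') {D : Set (ℕ → Fin 2)}
    (hD : MeasurableSet D) : ν (codeWord s u '' D) = ν (codeWord s' u' '' D) := by
  have he := measurableEmbedding_codeWord s u
  have he' := measurableEmbedding_codeWord s' u'
  have hval : ∀ ω, (he.equivRange ω : walkShift) = codeWord s u ω := fun ω => by
    rw [he.equivRange_apply]
  have hκ : IsHolonomy (ExchRel walkShift) (range (codeWord s u)) (range (codeWord s' u'))
      (he.equivRange.symm.trans he'.equivRange) := by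
    refine ⟨he.measurableSet_range, he'.measurableSet_range, fun x => ?_⟩
    obtain ⟨ω, rfl⟩ := he.equivRange.surjective x
    have hr : ExchRel walkShift (codeWord s u ω) (codeWord s' u' ω) := exchRel_code h ω
    simpa using hr
  have := hν _ _ _ hκ (he.equivRange '' D) (he.equivRange.measurableSet_image.2 hD)
  rw [image_image, image_image, image_image] at this
  simpa using this.symm

/-- On $[1]$ invariance makes word masses depend on weight only, which identifies the golden-mean
measure. The part of index `s` is carried by a prefix exchange into index 0, where its measure is
known. -/
theorem eq_exchMeasure {ν : Measure walkShift} (hν : IsInvariant (ExchRel walkShift) ν)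
    (hZ : ν twiceVisitedᶜ = 0) (h1 : ν (cyl walkShift 1) = 1) : ν = exchMeasure := by
  have hinter : ∀ E, ν (E ∩ twiceVisited) = ν E := fun E =>
    measure_inter_conull hZ
  have hcomap : ν.comap (code 0) = goldenMeasure := by
    have he := measurableEmbedding_code 0
    have : IsProbabilityMeasure (ν.comap (code 0)) := ⟨by
      rw [he.comap_apply, image_univ, ← cyl_one_inter_twiceVisited, hinter, h1]⟩
    refine eq_goldenMeasure fun u u' h => ?_
    rw [he.comap_apply, he.comap_apply, ← image_univ, ← image_univ, image_image, image_image]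
    exact hν.measure_image_codeWord (by rw [h]) MeasurableSet.univ
  ext E hE
  have hEs : ∀ s, code s '' (code s ⁻¹' E) = E ∩ range (code s) := fun s =>
    image_preimage_eq_inter_range
  rw [← hinter, exchMeasure_apply hE, twiceVisited_eq_iUnion, inter_iUnion, measure_iUnion]
  · refine tsum_congr fun s => ?_
    have h := hν.measure_image_codeWord (s := s) (u := []) (s' := 0)
      (u' := List.replicate (startLevel s) 0)
      (by simp [startLevel, weight, weight_replicate_zero]) (measurable_code s hE)
    have h' : codeWord 0 (List.replicate (startLevel s) 0) '' (code s ⁻¹' E) =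
        code 0 '' (prepend (List.replicate (startLevel s) 0) '' (code s ⁻¹' E)) := by
      rw [image_image]; rfl
    rw [← hEs]
    refine h.trans ?_
    rw [h', ← (measurableEmbedding_code 0).comap_apply, hcomap,
      goldenMeasure_image_prepend _ (measurable_code s hE), weight_replicate_zero]
  · intro s t hst
    rw [Function.onFun, Set.disjoint_left]
    rintro _ ⟨-, ω, rfl⟩ ⟨-, ω', h⟩
    exact hst (code_inj h).1.symm
  · exact fun s => hE.inter (measurableEmbedding_code s).measurableSet_range

theorem exchMeasure_singleton (x : walkShift) : exchMeasure {x} = 0 := by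
  rw [exchMeasure_apply (measurableSet_singleton x), ENNReal.tsum_eq_zero]
  intro s
  have h : goldenMeasure (code s ⁻¹' {x}) = 0 := by
    have hs : (code s ⁻¹' {x}).Subsingleton := fun a ha b hb =>
      (measurableEmbedding_code s).injective ((mem_singleton_iff.1 ha).trans
        (mem_singleton_iff.1 hb).symm)
    rcases hs.eq_empty_or_singleton with h | ⟨ω, h⟩
    · rw [h, measure_empty]
    · rw [h, goldenMeasure_singleton]
  rw [h, mul_zero]

/-- Some point of `A` has all its neighbourhoods meeting `A` in positive measure. As points are
null, outer regularity gives such a neighbourhood of measure less than that of `A`. -/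
theorem isNonAtomic_exchMeasure : IsNonAtomic exchMeasure := by
  intro A hA hpos
  obtain ⟨x, -, hx⟩ := exists_mem_forall_mem_nhdsWithin_pos_measure hpos.ne'
  obtain ⟨U, hxU, hU, hlt⟩ := Set.exists_isOpen_lt_of_lt {x} _
    ((exchMeasure_singleton x).trans_lt hpos)
  refine ⟨A ∩ U, inter_subset_left, hA.inter hU.measurableSet, ?_, ?_⟩
  · exact hx _ (Filter.inter_mem self_mem_nhdsWithin
      (mem_nhdsWithin_of_mem_nhds (hU.mem_nhds (hxU rfl))))
  · exact (measure_mono inter_subset_right).trans_lt hlt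

theorem isEphemeral_exchMeasure : IsEphemeral exchMeasure := by
  have hae : ∀ᵐ x ∂exchMeasure, x ∈ twiceVisited := by
    rw [ae_iff]
    exact exchMeasure_compl_twiceVisited
  intro s hs
  rcases le_or_gt s 0 with h | h
  · exact absurd (hae.mono fun x hx => hx.1 s h) hs
  · refine hae.mono fun x hx => ?_
    rw [hx.2 s h]
    exact ⟨by norm_num, ENat.natCast_lt_top 2⟩

theorem map_restrict_exchMeasure :
    (exchMeasure.restrict (cyl walkShift 1)).map Subtype.val = goldenMeasure.map blockPath := by
  rw [exchMeasure_restrict_cyl_one, Measure.map_map measurable_subtype_coe (measurable_code 0)]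
  congr 1
  funext ω
  exact codeSeq_zero_left ω

end ExchShift

open ExchShift in
/-- Among the `α`-`σ`-finite exchangeable ergodic measures on the simple aperiodic random walk
shift, exactly one is carried by `Z` and gives mass `1` to `[1]`; it is non-atomic and ephemeral,
and its restriction to `[1]` is the golden-mean product measure, read through the block coding. -/
theorem proposition6p2 :
    ∃ ν : Measure walkShift,
      (IsAlphaFinite ν ∧ IsInvariant (ExchRel walkShift) ν ∧ IsErgodic (ExchRel walkShift) ν ∧
        ν twiceVisitedᶜ = 0 ∧ ν (cyl walkShift 1) = 1) ∧
      (∀ ν' : Measure walkShift,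
        IsAlphaFinite ν' → IsInvariant (ExchRel walkShift) ν' →
        IsErgodic (ExchRel walkShift) ν' →
        ν' twiceVisitedᶜ = 0 → ν' (cyl walkShift 1) = 1 → ν' = ν) ∧
      IsNonAtomic ν ∧
      IsEphemeral ν ∧
      (ν.restrict (cyl walkShift 1)).map Subtype.val = goldenMeasure.map blockPath :=
  ⟨exchMeasure,
    ⟨isAlphaFinite_exchMeasure, isInvariant_exchMeasure, isErgodic_exchMeasure,
      exchMeasure_compl_twiceVisited, exchMeasure_cyl_one⟩,
    fun _ _ hinv _ hZ h1 => eq_exchMeasure hinv hZ h1,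
    isNonAtomic_exchMeasure, isEphemeral_exchMeasure, map_restrict_exchMeasure⟩
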